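/- For $x\in\mathbb{R}$ let $((x))=0$ if $x\in\mathbb{Z}$ and $((x))=\{x\}-\tfrac12$ otherwise. For coprime integers $a,b$ with $b>0$ let $$S(a,b)=12\sum_{k=1}^{b}\left(\!\left(\frac{k}{b}\right)\!\right)\left(\!\left(\frac{ak}{b}\right)\!\right)$$ be the normalized Dedekind sum. Let $q\ge 2$ be an integer which is even, or which is a perfect square divisible by $3$ or by $5$. Then the following hold. (1) For all integers $a,t$ with $t>0$, $t\mid a^2+1$ and $\gcd(aq,t)=1$, the number $\frac{(q^2-1)a}{t}-q\,S(aq,t)$ is an integer. Let $$\Lambda_q=\left\{\frac{(q^2-1)a}{t}-q\,S(aq,t) \bmod (q^2-1)\;:\; a,t\in\mathbb{Z},\ t>0,\ t\mid a^2+1,\ \gcd(aq,t)=1\right\}\subseteq \mathbb{Z}/(q^2-1)\mathbb{Z},$$ and let $\Gamma_q=\{24s : s\in\mathbb{Z}/(q^2-1)\mathbb{Z}\}$ if $q$ is a square, and $\Gamma_q=\{12s : s\in\mathbb{Z}/(q^2-1)\mathbb{Z}\}$ otherwise. Then $\Lambda_q=\Gamma_q$. (2) For every integer $k$ with $\gcd(k,q)=1$,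 there exist integers $a,b$ with $b\ge 1$, $\gcd(a,b)=1$ and $S(a,b)=\frac{k}{q}$ if and only if both of the following conditions hold: - if $3\nmid q$, then $3\mid k$; - if $2\nmid q$, then $k\equiv 2 \pmod 4$ when $q\equiv 3\pmod 4$; $k\equiv 0\pmod 8$ when $q$ is a square; and $k\equiv 0\pmod 4$ in all other cases. -/

import Mathlib

noncomputable section

open Classical in
/-- The sawtooth function: `0` at the integers and `{x} - 1/2` elsewhere. -/
def sawtooth (x : ℝ) : ℝ :=
  if ∃ n : ℤ, x = (n : ℝ) then 0 else Int.fract x - 1 / 2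

/-- The Dedekind sum `s(a,b) = ∑_{k=1}^{b} ((k/b)) ((ak/b))`; used only for `b > 0` and `a`
coprime to `b`. -/
def dedekindSum (a b : ℤ) : ℝ :=
  ∑ k ∈ Finset.Icc (1 : ℤ) b, sawtooth ((k : ℝ) / (b : ℝ)) * sawtooth ((a : ℝ) * (k : ℝ) / (b : ℝ))

/-- The normalized Dedekind sum `S(a,b) = 12 s(a,b)`. -/
def normDedekindSum (a b : ℤ) : ℝ := 12 * dedekindSum a b

/-- The number `(q² - 1) a / t - q S(aq, t)`. -/
def lambdaVal (q : ℕ) (a t : ℤ) : ℝ :=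
  ((q : ℝ) ^ 2 - 1) * (a : ℝ) / (t : ℝ) - (q : ℝ) * normDedekindSum (a * (q : ℤ)) t

/-- The pairs `(a, t)` over which `Λ_q` ranges: `t > 0`, `t ∣ a² + 1` and `gcd(aq, t) = 1`. -/
def IsAdmissible (q : ℕ) (a t : ℤ) : Prop :=
  0 < t ∧ t ∣ a ^ 2 + 1 ∧ Int.gcd (a * (q : ℤ)) t = 1

/-- `Λ_q ⊆ ℤ/(q²-1)ℤ`: the residues of the integers `(q² - 1) a / t - q S(aq, t)` over all
admissible `(a, t)`. -/
def LambdaSet (q : ℕ) : Set (ZMod (q ^ 2 - 1)) :=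
  {x | ∃ a t n : ℤ, IsAdmissible q a t ∧ lambdaVal q a t = (n : ℝ) ∧ x = (n : ZMod (q ^ 2 - 1))}

open Classical in
/-- `Γ_q ⊆ ℤ/(q²-1)ℤ`: the multiples of `24` if `q` is a square, otherwise those of `12`. -/
def GammaSet (q : ℕ) : Set (ZMod (q ^ 2 - 1)) :=
  if IsSquare q then {x | ∃ s : ZMod (q ^ 2 - 1), x = 24 * s}
  else {x | ∃ s : ZMod (q ^ 2 - 1), x = 12 * s}

/-- The local conditions on the numerator `k` for the reduced denominator `q`. The last three
cases are mutually exclusive, since an odd square is `1` modulo `4`. -/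
def LocalConditions (q : ℕ) (k : ℤ) : Prop :=
  (¬ 3 ∣ q → (3 : ℤ) ∣ k) ∧
  (¬ 2 ∣ q →
    (q ≡ 3 [MOD 4] → k ≡ 2 [ZMOD 4]) ∧
    (IsSquare q → k ≡ 0 [ZMOD 8]) ∧
    (¬ q ≡ 3 [MOD 4] → ¬ IsSquare q → k ≡ 0 [ZMOD 4]))

end

open NumberTheorySymbols

/-! Let λ(a,t) denote `lambdaVal q a t`. If S(a,b) = k/q in lowest terms, then b = qm with m ∣ a² +
1. Writing mt = a² + 1, the three-term relation gives q S(a,qm) = λ(a,t) + q S(r,q) with ar ≡ t mod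
q, provided t is prime to q (`normDedekindSum_mul_eq`). Adding jt to a leaves S(aq,t) alone and adds
(q² - 1)j to λ. Aiming at r = k, the value k/q is therefore attained once the class of k - q S(k,q)
lies in Λ_q, and (2) reduces to Λ_q = Γ_q and congruences.

Upper bound: the integer b S(a,b) is divisible by 3 when 3 ∤ b, and for odd b is b + 1 - 2J(a | b)
mod 8. If m ∣ a² + 1 then -1 is a square mod m and, for m odd, J(a | m) = J(2 | m); when q is an odd
square this forces divisibility by 8. Modulo q² - 1 these conditions cut out Γ_q: the prime 3
matters only if 3 ∤ q, the prime 2 only if q is odd.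

Lower bound: for each d ∣ q an explicit family, evaluated by a short Euclidean algorithm, puts every
multiple of d² - 1 in Λ_q. The divisors d = 2, 3, 5 give the multiples of 3, 8, 24, which suffices.
-/

/-! ### Sawtooth function: periodicity and oddness -/

theorem sawtooth_div_of_dvd {b x : ℤ} (hb : 0 < b) (h : b ∣ x) :
    sawtooth ((x : ℝ) / (b : ℝ)) = 0 := by
  obtain ⟨c, rfl⟩ := h
  have hb' : (b : ℝ) ≠ 0 := by exact_mod_cast hb.ne'
  rw [sawtooth, if_pos]
  exact ⟨c, by push_cast; field_simp⟩

theorem sawtooth_div_of_not_dvd {b x : ℤ} (hb : 0 < b) (h : ¬ b ∣ x) :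
    sawtooth ((x : ℝ) / (b : ℝ)) = ((x % b : ℤ) : ℝ) / b - 1 / 2 := by
  have hb' : (b : ℝ) ≠ 0 := by exact_mod_cast hb.ne'
  rw [sawtooth, if_neg]
  · lift b to ℕ using hb.le
    have := Int.fract_div_intCast_eq_div_intCast_mod (k := ℝ) (m := x) (n := b)
    push_cast at this ⊢
    rw [this]
  · rintro ⟨n, hn⟩
    apply h
    refine ⟨n, ?_⟩
    rw [div_eq_iff hb'] at hn
    have : x = n * b := by exact_mod_cast hn
    rw [this, mul_comm]

theorem sawtooth_div_congr {b x y : ℤ} (hb : 0 < b) (h : x ≡ y [ZMOD b]) :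
    sawtooth ((x : ℝ) / (b : ℝ)) = sawtooth ((y : ℝ) / (b : ℝ)) := by
  by_cases hx : b ∣ x
  · rw [sawtooth_div_of_dvd hb hx, sawtooth_div_of_dvd hb (h.dvd_iff.1 hx)]
  · rw [sawtooth_div_of_not_dvd hb hx,
      sawtooth_div_of_not_dvd hb (fun hy => hx (h.dvd_iff.2 hy)), h.eq]

theorem sawtooth_neg_div {b x : ℤ} (hb : 0 < b) :
    sawtooth (((-x : ℤ) : ℝ) / (b : ℝ)) = -sawtooth ((x : ℝ) / (b : ℝ)) := by
  have hb' : (b : ℝ) ≠ 0 := by exact_mod_cast hb.ne'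
  by_cases hx : b ∣ x
  · rw [sawtooth_div_of_dvd hb hx, sawtooth_div_of_dvd hb ((dvd_neg).2 hx), neg_zero]
  · rw [sawtooth_div_of_not_dvd hb hx, sawtooth_div_of_not_dvd hb (fun h => hx ((dvd_neg).1 h)),
      Int.neg_emod, if_neg hx]
    have : ((b.natAbs : ℤ)) = b := Int.natAbs_of_nonneg hb.le
    rw [this]
    push_cast
    field_simp
    ring

theorem normDedekindSum_congr {a a' b : ℤ} (hb : 0 < b) (h : a ≡ a' [ZMOD b]) :
    normDedekindSum a b = normDedekindSum a' b := by
  unfold normDedekindSum dedekindSum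
  congr 1
  refine Finset.sum_congr rfl fun k _ => ?_
  have := sawtooth_div_congr hb (h.mul_right k)
  push_cast at this
  rw [this]

theorem normDedekindSum_neg {a b : ℤ} (hb : 0 < b) :
    normDedekindSum (-a) b = -normDedekindSum a b := by
  unfold normDedekindSum dedekindSum
  rw [← mul_neg, ← Finset.sum_neg_distrib]
  congr 1
  refine Finset.sum_congr rfl fun k _ => ?_
  have := sawtooth_neg_div (x := a * k) hb
  rw [← neg_mul] at this
  push_cast at this ⊢
  rw [this, mul_neg]

theorem normDedekindSum_one (a : ℤ) : normDedekindSum a 1 = 0 := by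
  unfold normDedekindSum dedekindSum
  have := sawtooth_div_of_dvd (x := 1) one_pos dvd_rfl
  simp only [Finset.Icc_self, Finset.sum_singleton, this, zero_mul, mul_zero]

/-! ### Floor sums and the reciprocity law -/

theorem sum_range_mul_emod {M : Type*} [AddCommMonoid M] {a : ℤ} {b : ℕ} (h : IsCoprime a (b : ℤ))
    (hb : 0 < b) (φ : ℤ → M) :
    ∑ k ∈ Finset.range b, φ ((a * k) % b) = ∑ k ∈ Finset.range b, φ k := by
  have hb' : (0 : ℤ) < b := by exact_mod_cast hb
  have hinj : Set.InjOn (fun k : ℕ => ((a * k) % b : ℤ).toNat) (Finset.range b) := by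
    intro x hx y hy hxy
    simp only [Finset.coe_range, Set.mem_Iio] at hx hy
    have h1 : (a * x) % b = (a * y) % (b : ℤ) := by
      have h2 : (((a * x) % b : ℤ).toNat : ℤ) = ((a * y) % b : ℤ).toNat := by
        exact_mod_cast hxy
      rwa [Int.toNat_of_nonneg (Int.emod_nonneg _ hb'.ne'),
        Int.toNat_of_nonneg (Int.emod_nonneg _ hb'.ne')] at h2
    have h2 : (b : ℤ) ∣ a * (x - y) := by
      rw [mul_sub]; exact Int.ModEq.dvd (Eq.symm h1)
    have h3 : (b : ℤ) ∣ x - y := h.symm.dvd_of_dvd_mul_left h2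
    have := Int.eq_zero_of_abs_lt_dvd h3 (by rw [abs_lt]; omega)
    omega
  have himg : (Finset.range b).image (fun k : ℕ => ((a * k) % b : ℤ).toNat) = Finset.range b := by
    apply Finset.eq_of_subset_of_card_le
    · intro x hx
      simp only [Finset.mem_image, Finset.mem_range] at hx ⊢
      obtain ⟨k, _, rfl⟩ := hx
      have := Int.emod_lt_of_pos (a * k) hb'
      omega
    · rw [Finset.card_image_of_injOn hinj]
  conv_rhs => rw [← himg]
  rw [Finset.sum_image hinj]
  refine Finset.sum_congr rfl fun k _ => ?_
  rw [Int.toNat_of_nonneg (Int.emod_nonneg _ hb'.ne')]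

/-- The sawtooth vanishes at k = b, whereas {x} - 1/2 at k = 0 contributes 12 · 1/4; the -3 removes
it. -/
theorem normDedekindSum_eq_sum_range {a : ℤ} {b : ℕ} (h : IsCoprime a (b : ℤ)) (hb : 0 < b) :
    normDedekindSum a b = 12 * (∑ k ∈ Finset.range b,
      ((k : ℝ) / b - 1 / 2) * (((a * k % b : ℤ) : ℝ) / b - 1 / 2)) - 3 := by
  have hb' : (0 : ℤ) < b := by exact_mod_cast hb
  obtain ⟨c, rfl⟩ : ∃ c, b = c + 1 := ⟨b - 1, by omega⟩
  unfold normDedekindSum dedekindSum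
  have himg : Finset.Icc (1 : ℤ) ((c + 1 : ℕ) : ℤ)
      = (Finset.range (c + 1)).image (fun k : ℕ => (k : ℤ) + 1) := by
    ext x
    simp only [Finset.mem_Icc, Finset.mem_image, Finset.mem_range]
    constructor
    · intro hx; exact ⟨(x - 1).toNat, by omega, by omega⟩
    · rintro ⟨k, hk, rfl⟩; omega
  rw [himg, Finset.sum_image (by intro x _ y _ h; simpa using h), Finset.sum_range_succ,
    Finset.sum_range_succ']
  have h0 := sawtooth_div_of_dvd (x := (c : ℤ) + 1) hb' (by push_cast; exact dvd_rfl)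
  rw [h0]
  have : ∀ k ∈ Finset.range c,
      sawtooth ((((k : ℤ) + 1 : ℤ) : ℝ) / (((c + 1 : ℕ) : ℤ) : ℝ)) *
        sawtooth ((a : ℝ) * (((k : ℤ) + 1 : ℤ) : ℝ) / (((c + 1 : ℕ) : ℤ) : ℝ)) =
      (((k + 1 : ℕ) : ℝ) / (c + 1 : ℕ) - 1 / 2) *
        (((a * (k + 1 : ℕ) % (c + 1 : ℕ) : ℤ) : ℝ) / (c + 1 : ℕ) - 1 / 2) := by
    intro k hk
    rw [Finset.mem_range] at hk
    have hnd : ¬ (((c + 1 : ℕ) : ℤ) ∣ (k : ℤ) + 1) := by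
      intro hd
      have := Int.le_of_dvd (by omega) hd
      omega
    have hnd2 : ¬ (((c + 1 : ℕ) : ℤ) ∣ a * ((k : ℤ) + 1)) := fun hd =>
      hnd (h.symm.dvd_of_dvd_mul_left hd)
    have e1 := sawtooth_div_of_not_dvd hb' hnd
    have e2 := sawtooth_div_of_not_dvd hb' hnd2
    rw [e1, ← Int.cast_mul, e2, Int.emod_eq_of_lt (by omega) (by push_cast; omega)]
    push_cast
    ring
  rw [Finset.sum_congr rfl this]
  simp
  ring

/-- The sum `∑ k ⌊ak/b⌋` over `0 ≤ k < b`. -/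
def weightedFloorSum (a : ℤ) (b : ℕ) : ℤ := ∑ k ∈ Finset.range b, (k : ℤ) * (a * k / b)

theorem sum_range_cast_mul_two (b : ℕ) :
    2 * ∑ k ∈ Finset.range b, (k : ℝ) = (b : ℝ) * (b - 1) := by
  induction b with
  | zero => simp
  | succ n ih => rw [Finset.sum_range_succ, mul_add, ih]; push_cast; ring

theorem sum_range_cast_sq_mul_six (b : ℕ) :
    6 * ∑ k ∈ Finset.range b, (k : ℝ) ^ 2 = (b : ℝ) * (b - 1) * (2 * b - 1) := by
  induction b with
  | zero => simp
  | succ n ih => rw [Finset.sum_range_succ, mul_add, ih]; push_cast; ring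

theorem cast_emod_eq (a : ℤ) (b : ℕ) (k : ℕ) :
    ((a * k % b : ℤ) : ℝ) = a * k - b * ((a * k / b : ℤ) : ℝ) := by
  rw [Int.emod_def]; push_cast; ring

theorem mul_normDedekindSum {a : ℤ} {b : ℕ} (h : IsCoprime a (b : ℤ)) (hb : 0 < b) :
    (b : ℝ) * normDedekindSum a b =
      2 * a * (b - 1) * (2 * b - 1) - 12 * weightedFloorSum a b - 3 * b * (b - 1) := by
  have hb' : (b : ℝ) ≠ 0 := by exact_mod_cast hb.ne'
  have h1 := sum_range_cast_mul_two b
  have h2 := sum_range_cast_sq_mul_six b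
  have h3 := sum_range_mul_emod h hb (fun x => (x : ℝ))
  have h4 : ∑ k ∈ Finset.range b, (k : ℝ) * ((a * k % b : ℤ) : ℝ) =
      a * ∑ k ∈ Finset.range b, (k : ℝ) ^ 2 - b * weightedFloorSum a b := by
    rw [weightedFloorSum]
    push_cast
    rw [Finset.mul_sum, Finset.mul_sum, ← Finset.sum_sub_distrib]
    refine Finset.sum_congr rfl fun k _ => ?_
    rw [cast_emod_eq]; ring
  have h5 : ∑ k ∈ Finset.range b,
      ((k : ℝ) / b - 1 / 2) * (((a * k % b : ℤ) : ℝ) / b - 1 / 2) =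
      (∑ k ∈ Finset.range b, (k : ℝ) * ((a * k % b : ℤ) : ℝ)) / b ^ 2
      - (∑ k ∈ Finset.range b, (k : ℝ)) / (2 * b)
      - (∑ k ∈ Finset.range b, ((a * k % b : ℤ) : ℝ)) / (2 * b) + b / 4 := by
    have : (b : ℝ) / 4 = ∑ k ∈ Finset.range b, (1 / 4 : ℝ) := by simp; ring
    rw [this, Finset.sum_div, Finset.sum_div, Finset.sum_div, ← Finset.sum_sub_distrib,
      ← Finset.sum_sub_distrib, ← Finset.sum_add_distrib]
    refine Finset.sum_congr rfl fun k _ => ?_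
    field_simp
    ring
  simp only [Int.cast_natCast] at h3
  rw [normDedekindSum_eq_sum_range h hb, h5, h3, h4]
  field_simp
  linear_combination (-48 * b : ℝ) * h1 + 16 * a * h2

/-- Count the pairs (k, j) with bj ≤ ak, each with weight 2j. For fixed k they give f(f + 1) with f
= ⌊ak/b⌋; for fixed j > 0 there are b - 1 - ⌊bj/a⌋ of them, as coprimality excludes bj = ak. -/
theorem sum_div_mul_succ {a b : ℕ} (h : a.Coprime b) (ha : 0 < a) (hb : 0 < b) :
    ∑ k ∈ Finset.range b, (a * k / b) * (a * k / b + 1) + 2 * ∑ j ∈ Finset.range a, j * (b * j / a)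
      = 2 * (b - 1) * ∑ j ∈ Finset.range a, j := by
  have e1 : ∀ k ∈ Finset.range b, (a * k / b) * (a * k / b + 1) =
      ∑ j ∈ Finset.range a, if b * j ≤ a * k then 2 * j else 0 := by
    intro k hk
    rw [Finset.mem_range] at hk
    have hf : a * k / b < a := Nat.div_lt_of_lt_mul (by nlinarith)
    rw [← Finset.sum_filter]
    have : (Finset.range a).filter (fun j => b * j ≤ a * k) = Finset.range (a * k / b + 1) := by
      ext j
      simp only [Finset.mem_filter, Finset.mem_range, Nat.lt_succ_iff, Nat.le_div_iff_mul_le hb]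
      constructor
      · rintro ⟨_, h⟩; linarith
      · intro h
        refine ⟨?_, by linarith⟩
        by_contra hc
        have := (Nat.le_div_iff_mul_le hb).2 h
        omega
    rw [this, ← Finset.mul_sum, mul_comm 2, Finset.sum_range_id_mul_two]
    simp [mul_comm]
  rw [Finset.sum_congr rfl e1, Finset.sum_comm, Finset.mul_sum, Finset.mul_sum,
    ← Finset.sum_add_distrib]
  refine Finset.sum_congr rfl fun j hj => ?_
  rw [Finset.mem_range] at hj
  rcases Nat.eq_zero_or_pos j with rfl | hj0
  · simp
  have hg : b * j / a < b := Nat.div_lt_of_lt_mul (by nlinarith)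
  rw [← Finset.sum_filter]
  have : (Finset.range b).filter (fun k => b * j ≤ a * k) =
      (Finset.range b) \ (Finset.range (b * j / a + 1)) := by
    ext k
    simp only [Finset.mem_filter, Finset.mem_sdiff, Finset.mem_range, Nat.lt_succ_iff,
      Nat.le_div_iff_mul_le ha]
    refine and_congr_right fun _ => ?_
    constructor
    · intro h1 h2
      have h3 : b * j = a * k := by nlinarith
      have h4 : a ∣ j := h.dvd_of_dvd_mul_left (⟨k, h3⟩ : a ∣ b * j)
      have := Nat.le_of_dvd hj0 h4
      omega
    · intro h1; nlinarith
  rw [this, Finset.sum_const, Finset.card_sdiff_of_subset (by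
    intro x; simp only [Finset.mem_range]; omega), Finset.card_range, Finset.card_range, smul_eq_mul]
  obtain ⟨e, he⟩ : ∃ e, b = b * j / a + 1 + e := ⟨b - (b * j / a + 1), by omega⟩
  generalize b * j / a = g at *
  subst he
  have : g + 1 + e - (g + 1) = e := by omega
  rw [this]
  have : g + 1 + e - 1 = g + e := by omega
  rw [this]
  ring

/-- Since k ↦ ak permutes the residues mod b, summing the squares of ak mod b expresses ∑ k⌊ak/b⌋
through ∑ ⌊ak/b⌋². The lattice point count `sum_div_mul_succ` turns the latter into ∑ j⌊bj/a⌋. -/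
theorem normDedekindSum_reciprocity_nat {a b : ℕ} (h : a.Coprime b) (ha : 0 < a) (hb : 0 < b) :
    normDedekindSum a b + normDedekindSum b a = (a : ℝ) / b + b / a + 1 / (a * b) - 3 := by
  have hb' : (b : ℝ) ≠ 0 := by exact_mod_cast hb.ne'
  have ha' : (a : ℝ) ≠ 0 := by exact_mod_cast ha.ne'
  have hab : IsCoprime (a : ℤ) (b : ℤ) := Nat.isCoprime_iff_coprime.2 h
  have e1 := mul_normDedekindSum hab hb
  have e2 := mul_normDedekindSum hab.symm ha
  have p1 := sum_range_mul_emod hab hb (fun x => (x : ℝ))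
  have p2 := sum_range_mul_emod hab hb (fun x => (x : ℝ) ^ 2)
  have d := sum_div_mul_succ h ha hb
  have s1 := sum_range_cast_mul_two b
  have s2 := sum_range_cast_sq_mul_six b
  have s3 := sum_range_cast_mul_two a
  have wX : (weightedFloorSum a b : ℝ) = ∑ k ∈ Finset.range b, (k : ℝ) * ((a * k / b : ℕ) : ℝ) := by
    simp only [weightedFloorSum]
    push_cast
    refine Finset.sum_congr rfl fun k _ => ?_
    norm_cast
  have wY : (weightedFloorSum b a : ℝ) = ∑ k ∈ Finset.range a, (k : ℝ) * ((b * k / a : ℕ) : ℝ) := by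
    simp only [weightedFloorSum]
    push_cast
    refine Finset.sum_congr rfl fun k _ => ?_
    norm_cast
  have q1 : ∑ k ∈ Finset.range b, (((a : ℤ) * k % b : ℤ) : ℝ) =
      a * ∑ k ∈ Finset.range b, (k : ℝ) - b * ∑ k ∈ Finset.range b, ((a * k / b : ℕ) : ℝ) := by
    rw [Finset.mul_sum, Finset.mul_sum, ← Finset.sum_sub_distrib]
    refine Finset.sum_congr rfl fun k _ => ?_
    rw [cast_emod_eq]
    have : (((a : ℤ) * k / b : ℤ) : ℝ) = ((a * k / b : ℕ) : ℝ) := by norm_cast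
    rw [this]; push_cast; ring
  have q2 : ∑ k ∈ Finset.range b, (((a : ℤ) * k % b : ℤ) : ℝ) ^ 2 =
      a ^ 2 * ∑ k ∈ Finset.range b, (k : ℝ) ^ 2 - 2 * a * b * weightedFloorSum a b +
      b ^ 2 * ∑ k ∈ Finset.range b, ((a * k / b : ℕ) : ℝ) ^ 2 := by
    rw [wX, Finset.mul_sum, Finset.mul_sum, Finset.mul_sum, ← Finset.sum_sub_distrib,
      ← Finset.sum_add_distrib]
    refine Finset.sum_congr rfl fun k _ => ?_
    rw [cast_emod_eq]
    have : (((a : ℤ) * k / b : ℤ) : ℝ) = ((a * k / b : ℕ) : ℝ) := by norm_cast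
    rw [this]; push_cast; ring
  have d' : ∑ k ∈ Finset.range b, ((a * k / b : ℕ) : ℝ) ^ 2 +
      ∑ k ∈ Finset.range b, ((a * k / b : ℕ) : ℝ) + 2 * weightedFloorSum b a =
      2 * (b - 1) * ∑ j ∈ Finset.range a, (j : ℝ) := by
    rw [wY, ← Finset.sum_add_distrib]
    have := congrArg (Nat.cast : ℕ → ℝ) d
    push_cast [Nat.cast_sub hb] at this
    rw [← this]
    congr 1
    refine Finset.sum_congr rfl fun k _ => ?_
    ring
  simp only [Int.cast_natCast] at p1 p2
  rw [q1] at p1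
  rw [q2] at p2
  push_cast at e1 e2
  generalize ∑ k ∈ Finset.range b, (k : ℝ) = P1 at *
  generalize ∑ k ∈ Finset.range b, (k : ℝ) ^ 2 = P2 at *
  generalize ∑ k ∈ Finset.range a, (k : ℝ) = Q1 at *
  generalize ∑ k ∈ Finset.range b, ((a * k / b : ℕ) : ℝ) = F1 at *
  generalize ∑ k ∈ Finset.range b, ((a * k / b : ℕ) : ℝ) ^ 2 = F2 at *
  generalize (weightedFloorSum a b : ℝ) = X at *
  generalize (weightedFloorSum b a : ℝ) = Y at *
  field_simp
  apply mul_left_cancel₀ hb'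
  linear_combination (a * b : ℝ) * e1 + (b ^ 2 : ℝ) * e2 + 6 * p2 - 6 * b ^ 2 * d' - 6 * b * p1
    - 6 * b ^ 2 * (b - 1) * s3 - (a ^ 2 - 1) * s2 + 3 * b * (a - 1) * s1

theorem IsCoprime.of_modEq_left {a a' b : ℤ} (h : IsCoprime a b) (haa : a ≡ a' [ZMOD b]) :
    IsCoprime a' b := by
  obtain ⟨c, hc⟩ := haa.dvd
  rw [show a' = a + b * c by linarith]
  exact IsCoprime.add_mul_left_left h c

theorem exists_pos_nat_modEq (a : ℤ) {b : ℕ} (hb : 0 < b) :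
    ∃ c : ℕ, 0 < c ∧ a ≡ c [ZMOD b] := by
  have hb' : (0 : ℤ) < b := by exact_mod_cast hb
  have := Int.emod_nonneg a hb'.ne'
  refine ⟨(a % b + b).toNat, by omega, ?_⟩
  rw [Int.toNat_of_nonneg (by omega)]
  simp [Int.ModEq]

theorem normDedekindSum_reciprocity {a b : ℤ} (h : IsCoprime a b) (ha : 0 < a) (hb : 0 < b) :
    normDedekindSum a b + normDedekindSum b a = (a : ℝ) / b + b / a + 1 / (a * b) - 3 := by
  lift a to ℕ using ha.le
  lift b to ℕ using hb.le
  exact normDedekindSum_reciprocity_nat (Nat.isCoprime_iff_coprime.1 h) (by exact_mod_cast ha)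
    (by exact_mod_cast hb)

/-! ### Congruences for the integer b S(a,b) -/

/-- The integer `b S(a,b)`. -/
def scaledDedekindSum (a : ℤ) (b : ℕ) : ℤ :=
  2 * a * (b - 1) * (2 * b - 1) - 12 * weightedFloorSum a b - 3 * b * (b - 1)

theorem cast_scaledDedekindSum {a : ℤ} {b : ℕ} (h : IsCoprime a (b : ℤ)) (hb : 0 < b) :
    (scaledDedekindSum a b : ℝ) = b * normDedekindSum a b := by
  rw [mul_normDedekindSum h hb, scaledDedekindSum]
  push_cast
  ring

theorem three_dvd_scaledDedekindSum {a : ℤ} {b : ℕ} (hb : ¬ 3 ∣ b) :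
    3 ∣ scaledDedekindSum a b := by
  have h4 : (3 : ℤ) ∣ ((b : ℤ) - 1) * (2 * b - 1) := by
    rcases (by omega : (b : ℤ) % 3 = 1 ∨ (b : ℤ) % 3 = 2) with h | h
    · exact Dvd.dvd.mul_right (by omega) _
    · exact Dvd.dvd.mul_left (by omega) _
  obtain ⟨c, hc⟩ := h4
  exact ⟨2 * a * c - 4 * weightedFloorSum a b - b * (b - 1), by
    unfold scaledDedekindSum; linear_combination 2 * a * hc⟩

theorem scaledDedekindSum_congr {a a' : ℤ} {b : ℕ} (h : IsCoprime a (b : ℤ)) (hb : 0 < b)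
    (haa : a ≡ a' [ZMOD b]) : scaledDedekindSum a b = scaledDedekindSum a' b := by
  have h' : IsCoprime a' (b : ℤ) := IsCoprime.of_modEq_left h haa
  have := normDedekindSum_congr (by exact_mod_cast hb) haa
  have e1 := cast_scaledDedekindSum h hb
  rw [this, ← cast_scaledDedekindSum h' hb] at e1
  exact_mod_cast e1

theorem scaledDedekindSum_neg {a : ℤ} {b : ℕ} (h : IsCoprime a (b : ℤ)) (hb : 0 < b) :
    scaledDedekindSum (-a) b = -scaledDedekindSum a b := by
  have e1 := cast_scaledDedekindSum h.neg_left hb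
  rw [normDedekindSum_neg (by exact_mod_cast hb), mul_neg, ← cast_scaledDedekindSum h hb] at e1
  exact_mod_cast e1

theorem scaledDedekindSum_reciprocity {a b : ℕ} (h : a.Coprime b) (ha : 0 < a) (hb : 0 < b) :
    a * scaledDedekindSum a b + b * scaledDedekindSum b a
      = (a : ℤ) ^ 2 + b ^ 2 + 1 - 3 * a * b := by
  have hab : IsCoprime (a : ℤ) (b : ℤ) := Nat.isCoprime_iff_coprime.2 h
  have hb' : (b : ℝ) ≠ 0 := by exact_mod_cast hb.ne'
  have ha' : (a : ℝ) ≠ 0 := by exact_mod_cast ha.ne'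
  have e := normDedekindSum_reciprocity_nat h ha hb
  have : ((a * scaledDedekindSum a b + b * scaledDedekindSum b a : ℤ) : ℝ)
      = ((a ^ 2 + b ^ 2 + 1 - 3 * a * b : ℤ) : ℝ) := by
    push_cast
    rw [cast_scaledDedekindSum hab hb, cast_scaledDedekindSum hab.symm ha]
    field_simp at e
    linear_combination e
  exact_mod_cast this

theorem mul_scaledDedekindSum_modEq {a : ℤ} {b : ℕ} (h : IsCoprime a (b : ℤ)) (hb : 0 < b) :
    a * scaledDedekindSum a b ≡ a ^ 2 + 1 [ZMOD b] := by
  obtain ⟨c, hc0, hc⟩ := exists_pos_nat_modEq a hb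
  have hcop : IsCoprime (c : ℤ) (b : ℤ) := IsCoprime.of_modEq_left h hc
  rw [scaledDedekindSum_congr h hb hc]
  have e := scaledDedekindSum_reciprocity (Nat.isCoprime_iff_coprime.1 hcop) hc0 hb
  have : (c : ℤ) * scaledDedekindSum c b ≡ c ^ 2 + 1 [ZMOD b] := by
    refine (Int.modEq_iff_dvd.2 ⟨scaledDedekindSum b c - b + 3 * c, ?_⟩)
    linear_combination (-1) * e
  exact ((hc.mul_right _).trans this).trans ((hc.symm.pow 2).add_right 1)

/-- Dedekind and quadratic reciprocity combined mod 8, with e = J(b | a) and f = J(a | b). Here 4x =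
4 encodes that x is odd and 2x = 2 that x ≡ 1 mod 4. -/
theorem zmod_eight_reciprocity_aux : ∀ a b : ZMod 8, 4 * a = 4 → 4 * b = 4 → ∀ e f : ZMod 8,
    e ^ 2 = 1 → 2 * e = 2 ∨ 2 * e = -2 → f = (if 2 * a = 2 ∨ 2 * b = 2 then e else -e) →
    a * (a ^ 2 + b ^ 2 + 1 - 3 * a * b - b * (a + 1 - 2 * e)) = b + 1 - 2 * f := by
  decide +revert

/-- Both sides obey a reciprocity law, so strong induction on b works along the Euclidean algorithm,
provided the residues stay odd. -/
theorem scaledDedekindSum_modEq_eight {b : ℕ} (hb : Odd b) {a : ℤ} (h : IsCoprime a (b : ℤ)) :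
    scaledDedekindSum a b ≡ b + 1 - 2 * J(a | b) [ZMOD 8] := by
  induction b using Nat.strong_induction_on generalizing a with
  | _ b ih =>
  have hb0 : 0 < b := hb.pos
  have hb' : (0 : ℤ) < b := by exact_mod_cast hb0
  have key : ∀ c : ℕ, Odd c → c < b → c.Coprime b →
      scaledDedekindSum c b ≡ b + 1 - 2 * J((c : ℤ) | b) [ZMOD 8] := by
    intro c hc hcb hcop
    have hcop' : IsCoprime (c : ℤ) b := Nat.isCoprime_iff_coprime.2 hcop
    have e1 := ih c hcb hc hcop'.symm
    have e2 := scaledDedekindSum_reciprocity hcop hc.pos hb0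
    have e3 := jacobiSym.quadratic_reciprocity_if (Nat.odd_iff.1 hc) (Nat.odd_iff.1 hb)
    have e4 := jacobiSym.eq_one_or_neg_one (a := (b : ℤ)) (b := c)
      (Int.isCoprime_iff_gcd_eq_one.1 hcop'.symm)
    rw [← e3]
    replace e1 := (ZMod.intCast_eq_intCast_iff _ _ 8).2 e1
    have e2' := congrArg (Int.cast : ℤ → ZMod 8) e2
    have odd4 : ∀ x : ℕ, Odd x → (4 * x : ZMod 8) = 4 := by
      rintro x ⟨y, rfl⟩; push_cast; ring_nf
      rw [show (8 : ZMod 8) = 0 from rfl]; ring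
    have two2 : ∀ x : ℕ, Odd x → ((2 * x : ZMod 8) = 2 ↔ ¬ x % 4 = 3) := by
      intro x hx
      have : ((2 * x : ℕ) : ZMod 8) = ((2 : ℕ) : ZMod 8) ↔ ¬ x % 4 = 3 := by
        rw [ZMod.natCast_eq_natCast_iff, Nat.ModEq]
        rw [Nat.odd_iff] at hx
        omega
      simpa using this
    apply (ZMod.intCast_eq_intCast_iff _ _ 8).1
    have e5 := zmod_eight_reciprocity_aux c b (odd4 c hc) (odd4 b hb) ((J((b : ℤ) | c) : ℤ))
      ((if c % 4 = 3 ∧ b % 4 = 3 then -J((b : ℤ) | c) else J((b : ℤ) | c) : ℤ))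
      (by rcases e4 with h | h <;> rw [h] <;> decide)
      (by rcases e4 with h | h <;> rw [h] <;> decide)
      (by
        simp only [two2 c hc, two2 b hb]
        by_cases h1 : c % 4 = 3 <;> by_cases h2 : b % 4 = 3 <;> simp [h1, h2])
    have sq : ∀ x : ZMod 8, 4 * x = 4 → x ^ 2 = 1 := by decide
    have e6 := sq c (odd4 c hc)
    push_cast at e1 e2' e5 ⊢
    rw [e1] at e2'
    rw [← e5]
    linear_combination (c : ZMod 8) * e2' - (scaledDedekindSum c b : ZMod 8) * e6
  have hr0 := Int.emod_nonneg a hb'.ne'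
  have hrb := Int.emod_lt_of_pos a hb'
  obtain ⟨r, hr⟩ : ∃ r : ℕ, (r : ℤ) = a % b := ⟨(a % b).toNat, Int.toNat_of_nonneg hr0⟩
  have hmod : a ≡ r [ZMOD b] := by rw [hr]; exact (Int.mod_modEq _ _).symm
  have hcop : IsCoprime (r : ℤ) (b : ℤ) := IsCoprime.of_modEq_left h hmod
  rw [scaledDedekindSum_congr h hb0 hmod, jacobiSym.mod_left' (a₂ := (r : ℤ)) hmod]
  -- An even residue r is replaced by -(b - r), with b - r odd; the sum changes sign and the symbol
  -- is multiplied by χ₄(b).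
  rcases Nat.even_or_odd r with he | ho
  · obtain ⟨c, hc⟩ : ∃ c : ℕ, b = r + c := ⟨b - r, by omega⟩
    have hco : Odd c := by
      rw [Nat.odd_iff] at hb ⊢; rw [Nat.even_iff] at he; omega
    have hcb : IsCoprime (c : ℤ) (b : ℤ) := by
      have : (c : ℤ) = -r + b * 1 := by rw [hc]; push_cast; ring
      rw [this]; exact IsCoprime.add_mul_left_left hcop.neg_left 1
    have hcb' := Nat.isCoprime_iff_coprime.1 hcb
    rcases Nat.eq_zero_or_pos r with h0 | h0
    · subst h0
      have : b = 1 := by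
        have := hcop
        rw [Nat.cast_zero, isCoprime_zero_left] at this
        have := Int.isUnit_iff.1 this
        omega
      subst this
      simp [scaledDedekindSum, weightedFloorSum]
    · have e1 := key c hco (by omega) hcb'
      have hm : (r : ℤ) ≡ -c [ZMOD b] := by
        refine (Int.modEq_iff_dvd.2 ⟨-1, by rw [hc]; push_cast; ring⟩)
      rw [scaledDedekindSum_congr hcop hb0 hm, scaledDedekindSum_neg hcb hb0,
        jacobiSym.mod_left' (a₂ := -(c : ℤ)) hm, jacobiSym.neg _ hb, ZMod.χ₄_nat_eq_if_mod_four]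
      have e4 := jacobiSym.eq_one_or_neg_one (a := (c : ℤ)) (b := b)
        (Int.isCoprime_iff_gcd_eq_one.1 hcb)
      rw [Nat.odd_iff] at hb
      rw [Int.ModEq] at e1 ⊢
      have hb2 : ¬ b % 2 = 0 := by omega
      rw [if_neg hb2]
      split_ifs with h4 <;> rcases e4 with h | h <;> rw [h] at e1 ⊢ <;> omega
  · exact key r ho (by omega) (Nat.isCoprime_iff_coprime.1 hcop)

/-! ### The three-term relation -/

/-- Translating both fractions a/b and c/d by an integer, or applying x ↦ -1/x to both, preserves r
and s. Inversion alters the two sums by reciprocity, which matches the change in the rational term.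
Reducing c mod d and inverting lowers d. -/
theorem normDedekindSum_three_term {a b c d r s j k : ℤ} (hb : 0 < b) (hd : 0 < d)
    (hs : s = a * d - b * c) (hs0 : 0 < s) (hab : IsCoprime a b) (hjk : d * k - c * j = 1)
    (hr : r = a * j - b * k) :
    normDedekindSum a b = normDedekindSum c d + normDedekindSum r s +
      ((b : ℝ) ^ 2 + d ^ 2 + s ^ 2) / (b * d * s) - 3 := by
  obtain ⟨n, hn⟩ : ∃ n : ℕ, d.toNat = n := ⟨_, rfl⟩
  induction n using Nat.strong_induction_on generalizing a b c d j k with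
  | _ n ih =>
  have hc0 := Int.emod_nonneg c hd.ne'
  have hcd := Int.emod_lt_of_pos c hd
  obtain ⟨z, hz⟩ : ∃ z, c = c % d + d * z := ⟨c / d, (Int.emod_add_mul_ediv c d).symm⟩
  generalize hc' : c % d = c' at *
  obtain ⟨a', ha'⟩ : ∃ a', a = a' + b * z := ⟨a - b * z, by ring⟩
  obtain ⟨k', hk'⟩ : ∃ k', k = k' + z * j := ⟨k - z * j, by ring⟩
  have hjk' : d * k' - c' * j = 1 := by rw [hz, hk'] at hjk; linear_combination hjk
  have hr' : r = a' * j - b * k' := by rw [hr, ha', hk']; ring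
  have hs' : s = a' * d - b * c' := by rw [hs, ha', hz]; ring
  have hab' : IsCoprime a' b := by
    rw [show a' = a + b * (-z) by rw [ha']; ring]; exact IsCoprime.add_mul_left_left hab _
  have ea : a ≡ a' [ZMOD b] := Int.modEq_iff_dvd.2 ⟨-z, by rw [ha']; ring⟩
  have ec : c ≡ c' [ZMOD d] := Int.modEq_iff_dvd.2 ⟨-z, by rw [hz]; ring⟩
  rw [normDedekindSum_congr hb ea, normDedekindSum_congr hd ec]
  have hbR : (b : ℝ) ≠ 0 := by exact_mod_cast hb.ne'
  have hdR : (d : ℝ) ≠ 0 := by exact_mod_cast hd.ne'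
  have hsR : (s : ℝ) ≠ 0 := by exact_mod_cast hs0.ne'
  have hcd' : IsCoprime c' d := ⟨-j, k', by linear_combination hjk'⟩
  have ha0 : 0 < a' := by
    have : 0 < a' * d := by nlinarith
    exact pos_of_mul_pos_left this hd.le
  have haR : (a' : ℝ) ≠ 0 := by exact_mod_cast ha0.ne'
  have e1 := normDedekindSum_reciprocity hab' ha0 hb
  -- If c' = 0 then d = 1 and r ≡ -b mod a', so the claim is plain reciprocity.
  rcases hc0.eq_or_lt with h0 | h0
  · have hd1 : d = 1 := by
      rw [← h0] at hjk'
      exact Int.eq_one_of_mul_eq_one_right hd.le (by linarith)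
    have hs1 : s = a' := by rw [hs', ← h0, hd1]; ring
    have hk1 : k' = 1 := by rw [← h0, hd1] at hjk'; linarith
    have er : r ≡ -b [ZMOD a'] := Int.modEq_iff_dvd.2 ⟨-j, by rw [hr', hk1]; ring⟩
    rw [hs1, normDedekindSum_congr ha0 er, normDedekindSum_neg ha0, hd1, normDedekindSum_one]
    field_simp at e1 ⊢
    push_cast
    linear_combination e1
  · have e2 := normDedekindSum_reciprocity hcd' h0 hd
    have e3 := ih c'.toNat (by omega) (a := -b) (b := a') (c := -d) (d := c') (j := k') (k := -j)
      ha0 h0 (by rw [hs']; ring) hab'.symm.neg_left (by linear_combination hjk')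
      (by rw [hr']; ring) rfl
    rw [normDedekindSum_neg ha0, normDedekindSum_neg h0] at e3
    have hcR : (c' : ℝ) ≠ 0 := by exact_mod_cast h0.ne'
    have hsR' : (s : ℝ) = a' * d - b * c' := by rw [hs']; push_cast; ring
    have e4 : ((a' : ℝ) / b + b / a' + 1 / (a' * b)) - (c' / d + d / c' + 1 / (c' * d))
        + (a' ^ 2 + c' ^ 2 + s ^ 2) / (a' * c' * s) = (b ^ 2 + d ^ 2 + s ^ 2) / (b * d * s) := by
      field_simp
      rw [hsR']
      ring
    linear_combination e1 - e2 + e3 + e4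

/-! ### Divisors of a² + 1, and divisibility by 8 and 16 -/

theorem sq_add_one_emod_four (a : ℤ) : (a ^ 2 + 1) % 4 = 1 ∨ (a ^ 2 + 1) % 4 = 2 := by
  rcases Int.even_or_odd' a with ⟨c, rfl | rfl⟩
  · left; ring_nf; omega
  · right; ring_nf; omega

theorem not_three_dvd_of_dvd_sq_add_one {a t : ℤ} (h : t ∣ a ^ 2 + 1) : ¬ 3 ∣ t := by
  intro h3
  have h4 := h3.trans h
  rcases (by omega : a % 3 = 0 ∨ a % 3 = 1 ∨ a % 3 = 2) with h | h | h <;>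
  · have : (a ^ 2 + 1) % 3 = ((a % 3) ^ 2 + 1) % 3 := by simp [Int.add_emod, pow_two, Int.mul_emod]
    rw [h] at this
    omega

theorem isCoprime_of_dvd_sq_add_one {a t : ℤ} (h : t ∣ a ^ 2 + 1) : IsCoprime a t := by
  obtain ⟨m, hm⟩ := h
  exact ⟨-a, m, by linear_combination -hm⟩

theorem emod_four_of_odd_of_dvd_sq_add_one {a : ℤ} {t : ℕ} (ht : Odd t) (h : (t : ℤ) ∣ a ^ 2 + 1) :
    t % 4 = 1 := by
  have hc := isCoprime_of_dvd_sq_add_one h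
  have e1 := jacobiSym.sq_one' (Int.isCoprime_iff_gcd_eq_one.1 hc)
  have e2 : (a ^ 2) % t = (-1) % (t : ℤ) := Int.ModEq.symm
    (Int.modEq_iff_dvd.2 (by simpa using h))
  rw [jacobiSym.mod_left' e2, jacobiSym.at_neg_one ht, ZMod.χ₄_nat_eq_if_mod_four] at e1
  rw [Nat.odd_iff] at ht
  split_ifs at e1 <;> omega

/-- (1 + a)² ≡ 2a mod t, so J(2a | t) = 1. -/
theorem jacobiSym_of_dvd_sq_add_one {a : ℤ} {t : ℕ} (ht : Odd t) (h : (t : ℤ) ∣ a ^ 2 + 1) :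
    J(a | t) = J(2 | t) := by
  have hc := isCoprime_of_dvd_sq_add_one h
  have h2 : IsCoprime (2 : ℤ) t := by
    have := Nat.isCoprime_iff_coprime.2 (Nat.coprime_two_left.2 ht)
    exact_mod_cast this
  have e2 : (1 + a) ^ 2 ≡ 2 * a [ZMOD t] := Int.ModEq.symm
    (Int.modEq_iff_dvd.2 (by rw [show (1 + a) ^ 2 - 2 * a = a ^ 2 + 1 by ring]; exact h))
  have h3 : IsCoprime (1 + a) (t : ℤ) :=
    (IsCoprime.pow_left_iff two_pos).1 (IsCoprime.of_modEq_left (h2.mul_left hc) e2.symm)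
  have e1 := jacobiSym.sq_one' (Int.isCoprime_iff_gcd_eq_one.1 h3)
  rw [jacobiSym.mod_left' e2, jacobiSym.mul_left] at e1
  rcases jacobiSym.eq_one_or_neg_one (Int.isCoprime_iff_gcd_eq_one.1 h2) with h | h <;>
    rw [h] at e1 ⊢ <;> linarith

theorem sq_emod_eight_of_odd {x : ℕ} (hx : Odd x) : x ^ 2 % 8 = 1 := by
  obtain ⟨y, rfl⟩ := hx
  obtain ⟨z, hz⟩ := Nat.even_mul_succ_self y
  have : (2 * y + 1) ^ 2 = 8 * z + 1 := by linear_combination 4 * hz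
  omega

theorem mul_sq_emod_eight {m x : ℕ} (hx : Odd x) : m * x ^ 2 % 8 = m % 8 := by
  rw [Nat.mul_mod, sq_emod_eight_of_odd hx, mul_one, Nat.mod_mod]

theorem jacobiSym_mul_sq_left {a x : ℤ} {b : ℕ} (h : IsCoprime x b) :
    J(a * x ^ 2 | b) = J(a | b) := by
  rw [jacobiSym.mul_left, jacobiSym.sq_one' (Int.isCoprime_iff_gcd_eq_one.1 h), mul_one]

theorem jacobiSym_mul_sq_right {a : ℤ} {b x : ℕ} (hb : b ≠ 0) (hx : x ≠ 0) (h : IsCoprime a x) :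
    J(a | b * x ^ 2) = J(a | b) := by
  rw [jacobiSym.mul_right' _ hb (pow_ne_zero 2 hx), jacobiSym.pow_right,
    jacobiSym.sq_one (Int.isCoprime_iff_gcd_eq_one.1 h), mul_one]

/-- The square factors affect neither the symbol nor the modulus mod 8, leaving m + 1 - 2J(2 | m),
which vanishes mod 8 for m ≡ 1 and m ≡ 5. -/
theorem dvd_scaledDedekindSum_of_odd {a : ℤ} {m x y : ℕ} (hm : (m : ℤ) ∣ a ^ 2 + 1) (hmo : Odd m)
    (hy : Odd y)
    (h : IsCoprime (a * (x : ℤ) ^ 2) ((m * y ^ 2 : ℕ) : ℤ)) :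
    8 ∣ scaledDedekindSum (a * (x : ℤ) ^ 2) (m * y ^ 2) := by
  have hb : Odd (m * y ^ 2) := hmo.mul hy.pow
  have e := scaledDedekindSum_modEq_eight hb h
  have hxb : IsCoprime (x : ℤ) ((m * y ^ 2 : ℕ) : ℤ) :=
    (IsCoprime.pow_left_iff two_pos).1 h.of_mul_left_right
  have hay : IsCoprime a (y : ℤ) := by
    have := h.of_mul_left_left
    push_cast at this
    exact (IsCoprime.pow_right_iff two_pos).1 this.of_mul_right_right
  have h4 := emod_four_of_odd_of_dvd_sq_add_one hmo hm
  have h8 := mul_sq_emod_eight (m := m) hy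
  rw [jacobiSym_mul_sq_left hxb, jacobiSym_mul_sq_right hmo.pos.ne' hy.pos.ne' hay,
    jacobiSym_of_dvd_sq_add_one hmo hm, jacobiSym.at_two hmo, ZMod.χ₈_nat_eq_if_mod_eight] at e
  generalize m * y ^ 2 = b at *
  rw [Int.ModEq] at e
  split_ifs at e <;> omega

/-- The equations 2A = 2i and 2B = 2j in ℤ/16 fix A and B mod 8; the conditionals are the values of
χ₈. -/
theorem zmod_sixteen_aux : ∀ A B : ZMod 16, ∀ i ∈ ({1, 3, 5, 7} : Finset (ZMod 16)),
    ∀ j ∈ ({1, 5} : Finset (ZMod 16)), 2 * A = 2 * i → 2 * B = 2 * j →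
    A ^ 2 + 4 * B ^ 2 + 1 - 8 * A * B - 2 * B +
      4 * B * ((if i = 1 ∨ i = 7 then 1 else -1) * (if j = 1 then 1 else -1)) = 0 := by
  decide +kernel

theorem sixteen_dvd_aux {A B : ℕ} {σ : ℤ} (hA : A % 2 = 1) (hB : B % 4 = 1)
    (hσ : σ = ZMod.χ₈ A * ZMod.χ₈ B) :
    (16 : ℤ) ∣ A ^ 2 + 4 * B ^ 2 + 1 - 8 * A * B - 2 * B + 4 * B * σ := by
  apply (ZMod.intCast_zmod_eq_zero_iff_dvd _ 16).1
  have dbl : ∀ x i : ℕ, x % 8 = i → (2 * x : ZMod 16) = 2 * i := by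
    intro x i h
    have : ((2 * x : ℕ) : ZMod 16) = ((2 * i : ℕ) : ZMod 16) := by
      rw [ZMod.natCast_eq_natCast_iff, Nat.ModEq]
      omega
    simpa using this
  have hA8 : A % 8 = 1 ∨ A % 8 = 3 ∨ A % 8 = 5 ∨ A % 8 = 7 := by omega
  have hB8 : B % 8 = 1 ∨ B % 8 = 5 := by omega
  have hA0 : ¬ A % 2 = 0 := by omega
  have hB0 : ¬ B % 2 = 0 := by omega
  rw [ZMod.χ₈_nat_eq_if_mod_eight, ZMod.χ₈_nat_eq_if_mod_eight, if_neg hA0, if_neg hB0] at hσ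
  have key := zmod_sixteen_aux A B
  rcases hA8 with h1 | h1 | h1 | h1 <;> rcases hB8 with h2 | h2 <;>
  · have := key _ (by simp) _ (by simp) (dbl _ _ h1) (dbl _ _ h2)
    rw [h1, h2] at hσ
    rw [hσ]
    push_cast
    rw [← this]
    congr 1

/-- The mod 8 formula needs an odd modulus, so reciprocity exchanges the even modulus 2B, B = ny²,
for A = ax². There the sum is multiplied by 2B, which lifts its congruence from 8 to 16. -/
theorem dvd_scaledDedekindSum_of_even {a m x y : ℕ} (hm : (m : ℤ) ∣ (a : ℤ) ^ 2 + 1)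
    (hme : Even m) (hx : Odd x) (hy : Odd y)
    (h : (a * x ^ 2).Coprime (m * y ^ 2)) :
    16 ∣ scaledDedekindSum (a * x ^ 2 : ℕ) (m * y ^ 2) := by
  obtain ⟨n, hn⟩ := hme
  rw [← two_mul] at hn
  subst hn
  have hn0 : 0 < n := by
    rcases Nat.eq_zero_or_pos n with rfl | h0
    · rw [mul_zero, Nat.cast_zero, zero_dvd_iff] at hm; nlinarith
    · exact h0
  have hm' : (n : ℤ) ∣ (a : ℤ) ^ 2 + 1 := (Dvd.intro_left 2 (by push_cast; ring)).trans hm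
  have h44 := sq_add_one_emod_four a
  have h2 : (2 : ℤ) ∣ (a : ℤ) ^ 2 + 1 := (Dvd.intro (n : ℤ) (by push_cast; ring)).trans hm
  have hno : Odd n := by
    rw [← Nat.not_even_iff_odd]
    rintro ⟨l, hl⟩
    have : (4 : ℤ) ∣ (a : ℤ) ^ 2 + 1 := (Dvd.intro (l : ℤ) (by rw [hl]; push_cast; ring)).trans hm
    omega
  have hao : Odd a := by
    rw [← Nat.not_even_iff_odd]
    rintro ⟨l, hl⟩
    rw [hl] at h2
    have e : (((l + l : ℕ) : ℤ) ^ 2 + 1) = 2 * (2 * (l : ℤ) ^ 2) + 1 := by push_cast; ring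
    rw [e] at h2
    omega
  have hAo : Odd (a * x ^ 2) := hao.mul hx.pow
  have hBo : Odd (n * y ^ 2) := hno.mul hy.pow
  have h4 := emod_four_of_odd_of_dvd_sq_add_one hno hm'
  have e1 := scaledDedekindSum_modEq_eight hAo (Nat.isCoprime_iff_coprime.2 h.symm)
  have e2 := scaledDedekindSum_reciprocity h hAo.pos
    (by rw [mul_assoc]; have := hBo.pos; omega)
  have A8 := mul_sq_emod_eight (m := a) hx
  have B8 := mul_sq_emod_eight (m := n) hy
  have hb : 2 * n * y ^ 2 = 2 * (n * y ^ 2) := by ring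
  have c1 : IsCoprime (((2 * n * y ^ 2 : ℕ)) : ℤ) (x : ℤ) := by
    have := Nat.isCoprime_iff_coprime.2 h.symm
    push_cast at this ⊢
    exact (IsCoprime.pow_right_iff two_pos).1 this.of_mul_right_right
  have c2 : IsCoprime (y : ℤ) (a : ℤ) := by
    have := Nat.isCoprime_iff_coprime.2 h.symm
    push_cast at this
    exact (IsCoprime.pow_left_iff two_pos).1 this.of_mul_left_right.of_mul_right_left
  have eJ : J(((2 * n * y ^ 2 : ℕ) : ℤ) | a * x ^ 2) =
      ZMod.χ₈ (a * x ^ 2 : ℕ) * ZMod.χ₈ (n * y ^ 2 : ℕ) := by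
    rw [jacobiSym_mul_sq_right hao.pos.ne' hx.pos.ne' c1]
    push_cast
    rw [jacobiSym_mul_sq_left c2, jacobiSym.mul_left,
      jacobiSym.quadratic_reciprocity_one_mod_four h4 hao, jacobiSym_of_dvd_sq_add_one hno hm',
      jacobiSym.at_two hao, jacobiSym.at_two hno]
    have t : ∀ u v : ℕ, u % 8 = v % 8 → ZMod.χ₈ (u : ZMod 8) = ZMod.χ₈ (v : ZMod 8) := by
      intro u v huv
      rw [ZMod.χ₈_nat_mod_eight, huv, ← ZMod.χ₈_nat_mod_eight]
    rw [← t _ _ A8, ← t _ _ B8]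
    push_cast
    rfl
  rw [eJ] at e1
  have hA2 : (a * x ^ 2) % 2 = 1 := Nat.odd_iff.1 hAo
  have key := sixteen_dvd_aux (A := a * x ^ 2) (B := n * y ^ 2) hA2 (by omega) rfl
  rw [hb] at e1 e2 ⊢
  generalize (ZMod.χ₈ (a * x ^ 2 : ℕ) * ZMod.χ₈ (n * y ^ 2 : ℕ) : ℤ) = σ at *
  generalize a * x ^ 2 = A at *
  generalize n * y ^ 2 = B at *
  obtain ⟨e, he⟩ := e1.dvd
  obtain ⟨f, hf⟩ := key
  have hco : IsCoprime (16 : ℤ) (A : ℤ) := by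
    have : Nat.Coprime (2 ^ 4) A := Nat.Coprime.pow_left 4 (Nat.coprime_two_left.2 hAo)
    have := Nat.isCoprime_iff_coprime.2 this
    exact_mod_cast this
  refine hco.dvd_of_dvd_mul_left ⟨f + B * e, ?_⟩
  push_cast at e2 he hf ⊢
  linear_combination e2 + hf + 2 * B * he

/-! ### The link between S(a, qm) and Λ_q -/

/-- The fractions t/(aq) and a/(qm) have determinant q(mt - a²) = q, so the three-term relation
relates their sums by one of modulus q. Reciprocity then replaces S(t, aq) by S(aq, t). -/
theorem normDedekindSum_mul_eq {q : ℕ} (hq : 0 < q) {a m t r : ℤ} (ha : a ≠ 0) (ht : 0 < t)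
    (hmt : m * t = a ^ 2 + 1) (haq : IsCoprime a q) (htq : IsCoprime t q)
    (hr : a * r ≡ t [ZMOD q]) :
    normDedekindSum a (q * m) = ((q : ℝ) ^ 2 - 1) * a / (t * q) - normDedekindSum (a * q) t
      + normDedekindSum r q := by
  have hm : 0 < m := by
    have : 0 < m * t := by rw [hmt]; positivity
    exact pos_of_mul_pos_left this ht.le
  wlog hap : 0 < a generalizing a r
  · have e := this (a := -a) (r := -r) (neg_ne_zero.2 ha) (by rw [hmt]; ring) haq.neg_left
      (by rwa [neg_mul_neg]) (by omega)
    have hq' : (0 : ℤ) < q := by exact_mod_cast hq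
    rw [neg_mul, normDedekindSum_neg (by positivity), normDedekindSum_neg ht,
      normDedekindSum_neg hq'] at e
    push_cast at e
    linear_combination -e
  have hq' : (0 : ℤ) < q := by exact_mod_cast hq
  have hat : IsCoprime a t := isCoprime_of_dvd_sq_add_one ⟨m, by rw [← hmt]; ring⟩
  have ham : IsCoprime a m := isCoprime_of_dvd_sq_add_one ⟨t, by rw [← hmt]⟩
  obtain ⟨j, k, hjk⟩ : IsCoprime a (q * m) := haq.mul_right ham
  have hc : IsCoprime t (a * q) := hat.symm.mul_right htq
  have e1 := normDedekindSum_three_term (a := t) (b := a * q) (c := a) (d := q * m) (s := q)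
    (j := -j) (k := k) (r := t * -j - a * q * k) (by positivity) (by positivity)
    (by linear_combination (-(q : ℤ)) * hmt) hq' hc (by linear_combination hjk) rfl
  have hrr : t * -j - a * q * k ≡ -r [ZMOD q] := by
    obtain ⟨z, hz⟩ := hr.dvd
    refine Int.modEq_iff_dvd.2 ⟨j * z + a * k - m * k * r, ?_⟩
    linear_combination j * hz + r * hjk
  rw [normDedekindSum_congr hq' hrr, normDedekindSum_neg hq'] at e1
  have e2 := normDedekindSum_reciprocity hc ht (by positivity)
  have aR : (a : ℝ) ≠ 0 := by exact_mod_cast ha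
  have qR : (q : ℝ) ≠ 0 := by exact_mod_cast hq.ne'
  have tR : (t : ℝ) ≠ 0 := by exact_mod_cast ht.ne'
  have mR : (m : ℝ) ≠ 0 := by exact_mod_cast hm.ne'
  have hmR : (m : ℝ) = (a ^ 2 + 1) / t := by
    rw [eq_div_iff tR]; exact_mod_cast hmt
  have e3 : ((t : ℝ) / (a * q) + a * q / t + 1 / (t * (a * q)))
      - ((a * q) ^ 2 + (q * m) ^ 2 + q ^ 2) / (a * q * (q * m) * q)
      = ((q : ℝ) ^ 2 - 1) * a / (t * q) := by
    have hne : (a : ℝ) ^ 2 + 1 ≠ 0 := by positivity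
    rw [hmR]
    field_simp
    ring
  push_cast at e1 e2
  linear_combination e2 - e1 + e3

/-! ### Integrality and necessary congruences -/

theorem dvd_scaledDedekindSum {a : ℤ} {m x y : ℕ} (hm0 : 0 < m) (hm : (m : ℤ) ∣ a ^ 2 + 1)
    (hx : Odd x) (hy : Odd y) (h : IsCoprime (a * (x : ℤ) ^ 2) ((m * y ^ 2 : ℕ) : ℤ)) :
    (Odd m → 8 ∣ scaledDedekindSum (a * (x : ℤ) ^ 2) (m * y ^ 2)) ∧
    (Even m → 16 ∣ scaledDedekindSum (a * (x : ℤ) ^ 2) (m * y ^ 2)) := by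
  refine ⟨fun hmo => dvd_scaledDedekindSum_of_odd hm hmo hy h, fun hme => ?_⟩
  have hb : 0 < m * y ^ 2 := Nat.mul_pos hm0 (pow_pos hy.pos 2)
  obtain ⟨c, -, hc⟩ := exists_pos_nat_modEq a hb
  have h1 := hc.mul_right ((x : ℤ) ^ 2)
  have h2 := IsCoprime.of_modEq_left h h1
  rw [scaledDedekindSum_congr h hb h1]
  have hcm : (m : ℤ) ∣ (c : ℤ) ^ 2 + 1 := by
    have h3 : a ≡ c [ZMOD m] := hc.of_dvd (by push_cast; exact dvd_mul_right _ _)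
    exact ((h3.pow 2).add_right 1).dvd_iff.1 hm
  have := dvd_scaledDedekindSum_of_even hcm hme hx hy
    (Nat.isCoprime_iff_coprime.1 (by push_cast at h2 ⊢; exact h2))
  push_cast at this
  exact this

/-- As 4 ∤ a² + 1, cancelling m costs at most one factor 2; hence the 16 for even m. -/
theorem eight_dvd_of_dvd_mul {a n : ℤ} {m : ℕ} (hm : (m : ℤ) ∣ a ^ 2 + 1)
    (ho : Odd m → 8 ∣ m * n) (he : Even m → 16 ∣ m * n) : 8 ∣ n := by
  have odd_case : ∀ l : ℕ, Odd l → (8 : ℤ) ∣ l * n → 8 ∣ n := by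
    intro l hl h
    have : Nat.Coprime (2 ^ 3) l := Nat.Coprime.pow_left 3 (Nat.coprime_two_left.2 hl)
    have := Nat.isCoprime_iff_coprime.2 this
    exact IsCoprime.dvd_of_dvd_mul_left (by exact_mod_cast this) h
  rcases Nat.even_or_odd m with h | h
  · have h16 := he h
    obtain ⟨l, hl⟩ := h
    refine odd_case l ?_ ?_
    · rw [← Nat.not_even_iff_odd]
      rintro ⟨i, hi⟩
      have : (4 : ℤ) ∣ a ^ 2 + 1 :=
        (Dvd.intro (i : ℤ) (by rw [hl, hi]; push_cast; ring)).trans hm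
      have := sq_add_one_emod_four a
      omega
    · obtain ⟨z, hz⟩ := h16
      refine ⟨z, ?_⟩
      rw [hl] at hz
      push_cast at hz
      linarith
  · exact odd_case m h (ho h)

theorem lambdaVal_eq {q : ℕ} {a : ℤ} {t : ℕ} (h : IsAdmissible q a t) :
    ∃ n : ℤ, lambdaVal q a t = n ∧
      t * n = ((q : ℤ) ^ 2 - 1) * a - q * scaledDedekindSum (a * q) t := by
  obtain ⟨ht, hta, hg⟩ := h
  have ht' : 0 < t := by exact_mod_cast ht
  have hc := Int.isCoprime_iff_gcd_eq_one.2 hg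
  obtain ⟨z, hz⟩ := (mul_scaledDedekindSum_modEq hc ht').dvd
  obtain ⟨y, hy⟩ := hta
  -- Multiply by the unit a mod t, then use aq · t S(aq,t) ≡ (aq)² + 1 and a² ≡ -1.
  have hd : (t : ℤ) ∣ ((q : ℤ) ^ 2 - 1) * a - q * scaledDedekindSum (a * q) t := by
    refine (IsCoprime.symm hc.of_mul_left_left).dvd_of_dvd_mul_left ⟨z - y, ?_⟩
    linear_combination hz - hy
  obtain ⟨n, hn⟩ := hd
  refine ⟨n, ?_, hn.symm⟩
  have e := cast_scaledDedekindSum hc ht'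
  have tR : (t : ℝ) ≠ 0 := by exact_mod_cast ht'.ne'
  have hnR := congrArg (Int.cast : ℤ → ℝ) hn
  push_cast at hnR
  rw [e] at hnR
  rw [lambdaVal]
  push_cast
  field_simp
  linear_combination hnR

theorem three_dvd_sq_sub_one {q : ℕ} (h : ¬ 3 ∣ q) : (3 : ℤ) ∣ (q : ℤ) ^ 2 - 1 := by
  rcases (by omega : (q : ℤ) % 3 = 1 ∨ (q : ℤ) % 3 = 2) with h | h
  · rw [show (q : ℤ) ^ 2 - 1 = (q - 1) * (q + 1) by ring]
    exact Dvd.dvd.mul_right (by omega) _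
  · rw [show (q : ℤ) ^ 2 - 1 = (q - 1) * (q + 1) by ring]
    exact Dvd.dvd.mul_left (by omega) _

theorem sixteen_dvd_pow_four_sub_one {c : ℕ} (hc : Odd c) : (16 : ℤ) ∣ ((c : ℤ) ^ 2) ^ 2 - 1 := by
  have := sq_emod_eight_of_odd hc
  obtain ⟨y, hy⟩ : ∃ y, c ^ 2 = 8 * y + 1 := ⟨c ^ 2 / 8, by omega⟩
  have hy' : (c : ℤ) ^ 2 = 8 * y + 1 := by exact_mod_cast hy
  rw [hy']
  exact ⟨4 * y ^ 2 + y, by ring⟩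

theorem dvd_of_lambdaVal_eq {q : ℕ} {a : ℤ} {t : ℕ} (h : IsAdmissible q a t) {n : ℤ}
    (hn : lambdaVal q a t = n) :
    (¬ 3 ∣ q → 3 ∣ n) ∧ (Odd q → IsSquare q → 8 ∣ n) := by
  obtain ⟨n', hn', htn⟩ := lambdaVal_eq h
  obtain rfl : n = n' := by rw [hn] at hn'; exact_mod_cast hn'
  obtain ⟨ht, hta, hg⟩ := h
  have ht' : 0 < t := by exact_mod_cast ht
  have hc := Int.isCoprime_iff_gcd_eq_one.2 hg
  have ht3 := not_three_dvd_of_dvd_sq_add_one hta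
  constructor
  · intro h3
    have : (3 : ℤ) ∣ t * n := by
      rw [htn]
      exact dvd_sub (Dvd.dvd.mul_right (three_dvd_sq_sub_one h3) _)
        (Dvd.dvd.mul_left (three_dvd_scaledDedekindSum (by exact_mod_cast ht3)) _)
    exact (Int.prime_three.dvd_mul.1 this).resolve_left ht3
  · rintro ho ⟨c, rfl⟩
    have hco : Odd c := (Nat.odd_mul.1 ho).1
    have e : (a * ((c * c : ℕ) : ℤ)) = a * (c : ℤ) ^ 2 := by push_cast; ring
    rw [e] at hc htn
    have key := dvd_scaledDedekindSum (y := 1) ht' hta hco odd_one (by simpa using hc)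
    rw [one_pow, mul_one] at key
    have e2 : ((c * c : ℕ) : ℤ) ^ 2 - 1 = ((c : ℤ) ^ 2) ^ 2 - 1 := by push_cast; ring
    have h16 := sixteen_dvd_pow_four_sub_one hco
    rw [e2] at htn
    refine eight_dvd_of_dvd_mul hta (fun h => ?_) (fun h => ?_)
    · rw [htn]
      exact dvd_sub (Dvd.dvd.mul_right (dvd_trans (by norm_num) h16) _)
        (Dvd.dvd.mul_left (key.1 h) _)
    · rw [htn]
      exact dvd_sub (Dvd.dvd.mul_right h16 _) (Dvd.dvd.mul_left (key.2 h) _)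

/-- Since b S(a,b) is an integer, q ∣ b; with b = qm it equals mk, and amk ≡ a² + 1 mod qm yields m
∣ a² + 1. -/
theorem dvd_of_normDedekindSum_eq {q : ℕ} (hq : 0 < q) {k : ℤ} (hk : IsCoprime k q) {a : ℤ} {b : ℕ}
    (hb : 0 < b) (hab : IsCoprime a b) (h : normDedekindSum a b = (k : ℝ) / q) :
    (¬ 3 ∣ q → 3 ∣ k) ∧ (Odd q → IsSquare q → 8 ∣ k) := by
  have qR : (q : ℝ) ≠ 0 := by exact_mod_cast hq.ne'
  have e := cast_scaledDedekindSum hab hb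
  have e1 : (q : ℤ) * scaledDedekindSum a b = b * k := by
    have : (q : ℝ) * scaledDedekindSum a b = b * k := by
      rw [e, h]; field_simp
    exact_mod_cast this
  have hqb : q ∣ b := by
    have : (q : ℤ) ∣ b := hk.symm.dvd_of_dvd_mul_right ⟨_, e1.symm⟩
    exact_mod_cast this
  obtain ⟨m, rfl⟩ := hqb
  have hm0 : 0 < m := Nat.pos_of_mul_pos_left hb
  have e2 : scaledDedekindSum a (q * m) = m * k := by
    have hq0 : (q : ℤ) ≠ 0 := by exact_mod_cast hq.ne'
    apply mul_left_cancel₀ hq0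
    rw [e1]; push_cast; ring
  have hma : (m : ℤ) ∣ a ^ 2 + 1 := by
    obtain ⟨z, hz⟩ := (mul_scaledDedekindSum_modEq hab hb).dvd
    rw [e2] at hz
    push_cast at hz
    exact ⟨q * z + a * k, by linear_combination hz⟩
  have hm3 := not_three_dvd_of_dvd_sq_add_one hma
  constructor
  · intro h3
    have : ¬ 3 ∣ q * m := by
      rw [Nat.prime_three.dvd_mul]
      rintro (h | h)
      · exact h3 h
      · exact hm3 (by exact_mod_cast h)
    have := three_dvd_scaledDedekindSum (a := a) this
    rw [e2] at this
    exact (Int.prime_three.dvd_mul.1 this).resolve_left hm3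
  · rintro ho ⟨c, rfl⟩
    have hco : Odd c := (Nat.odd_mul.1 ho).1
    have eb : c * c * m = m * c ^ 2 := by ring
    rw [eb] at e2 hab
    have key := dvd_scaledDedekindSum (x := 1) hm0 hma odd_one hco (by simpa using hab)
    rw [Nat.cast_one, one_pow, mul_one, e2] at key
    exact eight_dvd_of_dvd_mul hma key.1 key.2

theorem dvd_scaledDedekindSum_self {q : ℕ} (hq : 0 < q) {k : ℤ} (hk : IsCoprime k q) :
    (¬ 3 ∣ q → 3 ∣ scaledDedekindSum k q) ∧
    (Odd q → IsSquare q → 8 ∣ scaledDedekindSum k q) := by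
  refine ⟨fun h => three_dvd_scaledDedekindSum h, ?_⟩
  rintro ho ⟨c, rfl⟩
  have hco : Odd c := (Nat.odd_mul.1 ho).1
  have key := dvd_scaledDedekindSum (a := k) (x := 1) (m := 1) one_pos (by simp) odd_one hco
    (by rw [Nat.cast_one, one_pow, mul_one, one_mul, pow_two]; exact hk)
  rw [Nat.cast_one, one_pow, mul_one, one_mul, pow_two] at key
  exact key.1 odd_one

/-! ### The equality Λ_q = Γ_q -/

theorem natCast_sq_eq_one {q : ℕ} (hq : 0 < q) : (q : ZMod (q ^ 2 - 1)) ^ 2 = 1 := by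
  have h : q ^ 2 - 1 + 1 = q ^ 2 := Nat.sub_add_cancel (Nat.pow_pos hq)
  have := congrArg (Nat.cast : ℕ → ZMod (q ^ 2 - 1)) h
  rw [Nat.cast_add, ZMod.natCast_self, zero_add] at this
  push_cast at this
  exact this.symm

/-- The multiples of 24 mod N are the classes divisible by gcd(N, 24). -/
theorem exists_intCast_eq_mul {N : ℕ} {L : ℤ} (h3 : 3 ∣ N → 3 ∣ L) (h8 : Even N → 8 ∣ L) :
    ∃ s : ZMod N, (L : ZMod N) = 24 * s := by
  have g3 : ((Nat.gcd N 3 : ℕ) : ℤ) ∣ L := by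
    by_cases h : 3 ∣ N
    · exact (Int.natCast_dvd_natCast.2 (Nat.gcd_dvd_right N 3)).trans (h3 h)
    · rw [Nat.Coprime.gcd_eq_one (((Nat.Prime.coprime_iff_not_dvd Nat.prime_three).2 h).symm)]
      simp
  have g8 : ((Nat.gcd N 8 : ℕ) : ℤ) ∣ L := by
    by_cases h : Even N
    · exact (Int.natCast_dvd_natCast.2 (Nat.gcd_dvd_right N 8)).trans (h8 h)
    · have : Nat.Coprime N (2 ^ 3) :=
        (Nat.coprime_two_right.2 (Nat.not_even_iff_odd.1 h)).pow_right 3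
      rw [show (8 : ℕ) = 2 ^ 3 by norm_num, this.gcd_eq_one]
      simp
  have hco : Nat.Coprime (Nat.gcd N 3) (Nat.gcd N 8) :=
    Nat.Coprime.coprime_dvd_left (Nat.gcd_dvd_right N 3)
      (Nat.Coprime.coprime_dvd_right (Nat.gcd_dvd_right N 8) (by norm_num))
  have g24 : ((Nat.gcd N 24 : ℕ) : ℤ) ∣ L := by
    rw [show 24 = 3 * 8 by norm_num, Nat.Coprime.gcd_mul N (by norm_num : Nat.Coprime 3 8)]
    push_cast
    exact IsCoprime.mul_dvd (Nat.isCoprime_iff_coprime.2 hco) g3 g8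
  obtain ⟨l, hl⟩ := g24
  have hbez := Nat.gcd_eq_gcd_ab N 24
  refine ⟨((Nat.gcdB N 24 * l : ℤ) : ZMod N), ?_⟩
  rw [hl, hbez]
  push_cast
  rw [ZMod.natCast_self]
  ring

theorem intCast_mem_GammaSet {q : ℕ} (hq : 0 < q) (hq2 : Even q ∨ IsSquare q) {L : ℤ}
    (h3 : ¬ 3 ∣ q → 3 ∣ L) (h8 : Odd q → IsSquare q → 8 ∣ L) :
    (L : ZMod (q ^ 2 - 1)) ∈ GammaSet q := by
  have hN : q ^ 2 - 1 + 1 = q ^ 2 := Nat.sub_add_cancel (Nat.pow_pos hq)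
  have key : ∃ s : ZMod (q ^ 2 - 1), (L : ZMod (q ^ 2 - 1)) = 24 * s := by
    refine exists_intCast_eq_mul (fun h => h3 fun h' => ?_) (fun h => ?_)
    · have : 3 ∣ q ^ 2 := Dvd.dvd.pow h' two_ne_zero
      omega
    · have ho : Odd q := by
        rw [← Nat.not_even_iff_odd]
        intro he
        have : Even (q ^ 2) := he.pow_of_ne_zero two_ne_zero
        rw [Nat.even_iff] at h this
        omega
      exact h8 ho (hq2.resolve_left (Nat.not_even_iff_odd.2 ho))
  obtain ⟨s, hs⟩ := key
  unfold GammaSet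
  split_ifs
  · exact ⟨s, hs⟩
  · exact ⟨2 * s, by rw [hs]; ring⟩

/-- The parameters are chosen so that the Euclidean algorithm for S(aq,t), q = de, has bounded
length: aq ≡ -ew mod t, t ≡ u + 1 mod ew, ew ≡ -ed² mod u + 1, u + 1 ≡ 1 mod ed². Four reciprocities
evaluate the sum. -/
theorem exists_admissible_lambdaVal_eq {d e : ℕ} (hd : 0 < d) (he : 0 < e) (k : ℕ) :
    ∃ a t : ℤ, IsAdmissible (d * e) a t ∧
      lambdaVal (d * e) a t = ((d * e * (d ^ 2 - 1) * k : ℤ) : ℝ) := by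
  obtain ⟨u, hu⟩ : ∃ u : ℤ, u = e * d ^ 2 * k := ⟨_, rfl⟩
  obtain ⟨w, hw⟩ : ∃ w : ℤ, w = 1 + (1 + d ^ 2) * u := ⟨_, rfl⟩
  obtain ⟨t, ht⟩ : ∃ t : ℤ, t = 1 + 2 * u + (1 + d ^ 2) * u ^ 2 := ⟨_, rfl⟩
  obtain ⟨a, ha⟩ : ∃ a : ℤ, a = d * e * k * (1 - d ^ 2 + (1 + d ^ 2) * u) := ⟨_, rfl⟩
  have hu0 : 0 ≤ u := by rw [hu]; positivity
  have hw0 : 0 < w := by rw [hw]; positivity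
  have ht0 : 0 < t := by rw [ht]; positivity
  have he0 : (0 : ℤ) < e := by exact_mod_cast he
  have hd0 : (0 : ℤ) < d := by exact_mod_cast hd
  have haq : a * (d * e) = e * t - e * w := by rw [ha, ht, hw, hu]; ring
  -- With κ = dek and u = dκ, t = (1 + u)² + (du)² and the cofactor is (1 - u)² + κ²; Brahmagupta's
  -- identity writes the product as 1 + a².
  have hta : t ∣ a ^ 2 + 1 :=
    ⟨1 - 2 * (d * e * k) * d + (d * e * k) ^ 2 * (1 + d ^ 2), by rw [ha, ht, hu]; ring⟩
  have c3 : IsCoprime (e * (d : ℤ) ^ 2) (u + 1) := ⟨-k, 1, by rw [hu]; ring⟩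
  have c2 : IsCoprime (e * w) (u + 1) := by
    rw [show (e : ℤ) * w = -(e * d ^ 2) + (u + 1) * (e * (1 + d ^ 2)) by rw [hw]; ring]
    exact IsCoprime.add_mul_left_left c3.neg_left _
  have c1 : IsCoprime (e * w) t := by
    rw [show t = (u + 1) + e * w * (d ^ 2 * k) by rw [ht, hw, hu]; ring]
    exact IsCoprime.add_mul_left_right c2 _
  have hcop : IsCoprime (a * (d * e)) t := by
    rw [haq, show (e : ℤ) * t - e * w = -(e * w) + t * e by ring]
    exact IsCoprime.add_mul_left_left c1.neg_left _
  refine ⟨a, t, ⟨ht0, hta, Int.isCoprime_iff_gcd_eq_one.1 (by push_cast; exact hcop)⟩, ?_⟩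
  have s1 := normDedekindSum_reciprocity c1 (by positivity) ht0
  have s2 := normDedekindSum_reciprocity c2.symm (by positivity) (by positivity)
  have s3 := normDedekindSum_reciprocity c3 (by positivity) (by positivity)
  have s4 := normDedekindSum_reciprocity (a := 1) (b := e * (d : ℤ) ^ 2) isCoprime_one_left one_pos
    (by positivity)
  have m0 : a * (d * e) ≡ -(e * w) [ZMOD t] := by
    rw [haq]; exact Int.modEq_iff_dvd.2 ⟨-e, by ring⟩
  have m1 : t ≡ u + 1 [ZMOD (e * w)] := Int.modEq_iff_dvd.2 ⟨-(d ^ 2 * k), by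
    rw [ht, hw, hu]; ring⟩
  have m2 : e * w ≡ -(e * (d : ℤ) ^ 2) [ZMOD (u + 1)] := Int.modEq_iff_dvd.2
    ⟨-(e * (1 + d ^ 2)), by rw [hw]; ring⟩
  have m3 : u + 1 ≡ 1 [ZMOD (e * (d : ℤ) ^ 2)] := Int.modEq_iff_dvd.2 ⟨-k, by rw [hu]; ring⟩
  rw [normDedekindSum_congr (by positivity) m1] at s1
  rw [normDedekindSum_congr (a := e * w) (by positivity) m2,
    normDedekindSum_neg (by positivity)] at s2
  rw [normDedekindSum_congr (a := u + 1) (by positivity) m3] at s3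
  rw [normDedekindSum_one] at s4
  have S : normDedekindSum (a * (d * e)) t = -normDedekindSum (e * w) t := by
    rw [normDedekindSum_congr ht0 m0, normDedekindSum_neg ht0]
  rw [lambdaVal]
  push_cast
  rw [S]
  have eR : (e : ℝ) ≠ 0 := by exact_mod_cast he.ne'
  have dR : (d : ℝ) ≠ 0 := by exact_mod_cast hd.ne'
  have wR : (w : ℝ) ≠ 0 := by exact_mod_cast hw0.ne'
  have tR : (t : ℝ) ≠ 0 := by exact_mod_cast ht0.ne'
  have uR : (u : ℝ) + 1 ≠ 0 := by
    have : (0 : ℝ) ≤ u := by exact_mod_cast hu0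
    positivity
  push_cast at s1 s2 s3 s4
  have key : (((d : ℝ) * e) ^ 2 - 1) * a / t + d * e * (
      ((e : ℝ) * w / t + t / (e * w) + 1 / (e * w * t))
      - ((u + 1) / (e * w) + e * w / (u + 1) + 1 / ((u + 1) * (e * w)))
      - (e * d ^ 2 / (u + 1) + (u + 1) / (e * d ^ 2) + 1 / (e * d ^ 2 * (u + 1)))
      + (1 / (e * d ^ 2) + e * d ^ 2 / 1 + 1 / (1 * (e * d ^ 2)))) =
      d * e * (d ^ 2 - 1) * k := by
    have hwR : (w : ℝ) = 1 + (1 + d ^ 2) * u := by rw [hw]; push_cast; ring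
    have htR : (t : ℝ) = 1 + 2 * u + (1 + d ^ 2) * u ^ 2 := by rw [ht]; push_cast; ring
    have huR : (u : ℝ) = e * d ^ 2 * k := by rw [hu]; push_cast; ring
    have haR : (a : ℝ) = d * e * k * (1 - d ^ 2 + (1 + d ^ 2) * u) := by rw [ha]; push_cast; ring
    have hkR : (k : ℝ) = u / (e * d ^ 2) := by rw [huR]; field_simp
    rw [haR, hkR]
    rw [htR] at tR ⊢
    rw [hwR] at wR ⊢
    field_simp
    ring
  linear_combination key + d * e * (s1 - s2 - s3 + s4)

theorem mul_mem_LambdaSet {q d : ℕ} (hq : 2 ≤ q) (hd : 0 < d) (hdq : d ∣ q)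
    (s : ZMod (q ^ 2 - 1)) : ((d : ZMod (q ^ 2 - 1)) ^ 2 - 1) * s ∈ LambdaSet q := by
  have hsq := natCast_sq_eq_one (q := q) (by omega)
  have : NeZero (q ^ 2 - 1) := ⟨by have := Nat.pow_le_pow_left hq 2; omega⟩
  obtain ⟨e, rfl⟩ := hdq
  have he : 0 < e := Nat.pos_of_ne_zero (by rintro rfl; omega)
  -- The extra factor de = q makes the value q²(d² - 1)s, and q² = 1 in the ring.
  obtain ⟨a, t, h1, h2⟩ := exists_admissible_lambdaVal_eq hd he (d * e * s.val)
  refine ⟨a, t, _, h1, h2, ?_⟩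
  push_cast at hsq ⊢
  rw [ZMod.natCast_zmod_val]
  linear_combination (-((d : ZMod ((d * e) ^ 2 - 1)) ^ 2 - 1) * s) * hsq

theorem LambdaSet_eq_GammaSet {q : ℕ} (hq : 2 ≤ q)
    (h : Even q ∨ (IsSquare q ∧ (3 ∣ q ∨ 5 ∣ q))) : LambdaSet q = GammaSet q := by
  apply Set.Subset.antisymm
  · rintro x ⟨a, t, n, h1, h2, rfl⟩
    obtain ⟨t, rfl⟩ := Int.eq_ofNat_of_zero_le h1.1.le
    have := dvd_of_lambdaVal_eq h1 h2
    exact intCast_mem_GammaSet (by omega) (h.imp_right And.left) this.1 this.2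
  · intro x hx
    have key : (Even q ∧ ∃ s, x = 12 * s) ∨ (IsSquare q ∧ (3 ∣ q ∨ 5 ∣ q)) ∧ ∃ s, x = 24 * s := by
      unfold GammaSet at hx
      split_ifs at hx with hs
      · obtain ⟨s, rfl⟩ := hx
        rcases h with h | h
        · exact Or.inl ⟨h, 2 * s, by ring⟩
        · exact Or.inr ⟨h, s, rfl⟩
      · exact Or.inl ⟨h.resolve_right (fun h => hs h.1), hx⟩
    -- The divisors d = 2, 3, 5 apply through 12 = 3 · 4, 24 = 8 · 3 and 24 = 5² - 1.
    rcases key with ⟨he, s, rfl⟩ | ⟨⟨_, h3 | h5⟩, s, rfl⟩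
    · have := mul_mem_LambdaSet hq two_pos he.two_dvd (4 * s)
      convert this using 1; push_cast; ring
    · have := mul_mem_LambdaSet hq three_pos h3 (3 * s)
      convert this using 1; push_cast; ring
    · have := mul_mem_LambdaSet hq (d := 5) (by norm_num) h5 s
      convert this using 1; push_cast; ring

/-! ### Realizing k/q, and the main theorem -/

theorem exists_normDedekindSum_eq {q : ℕ} (hq : 2 ≤ q) {k : ℤ} (hk : IsCoprime k q)
    (h : ((k - scaledDedekindSum k q : ℤ) : ZMod (q ^ 2 - 1)) ∈ LambdaSet q) :
    ∃ a b : ℤ, 1 ≤ b ∧ Int.gcd a b = 1 ∧ normDedekindSum a b = (k : ℝ) / q := by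
  obtain ⟨a₀, t, n, hadm, hlam, hkn⟩ := h
  obtain ⟨t, rfl⟩ := Int.eq_ofNat_of_zero_le hadm.1.le
  obtain ⟨n', hn', htn⟩ := lambdaVal_eq hadm
  obtain rfl : n = n' := by rw [hlam] at hn'; exact_mod_cast hn'
  obtain ⟨ht, hta, hg⟩ := hadm
  have hq0 : 0 < q := by omega
  have hq' : (0 : ℤ) < q := by exact_mod_cast hq0
  have hco := Int.isCoprime_iff_gcd_eq_one.2 hg
  have htq : IsCoprime (t : ℤ) q := hco.of_mul_left_right.symm
  obtain ⟨j, hj⟩ : ((q ^ 2 - 1 : ℕ) : ℤ) ∣ k - scaledDedekindSum k q - n :=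
    ((ZMod.intCast_eq_intCast_iff _ _ _).1 hkn.symm).dvd
  rw [Nat.cast_sub (Nat.pow_pos hq0)] at hj
  push_cast at hj
  obtain ⟨z, hz⟩ := (mul_scaledDedekindSum_modEq hk hq0).dvd
  -- This shift turns the congruence mod q² - 1 into the equality λ(a,t) = k - q S(k,q).
  obtain ⟨a, ha⟩ : ∃ a, a = a₀ + j * t := ⟨_, rfl⟩
  -- Modulo q, tλ(a,t) ≡ -a gives t(k - q S(k,q)) ≡ -a; multiply by k and use k · q S(k,q) ≡ k² + 1.
  have hak : a * k ≡ t [ZMOD q] := by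
    refine Int.modEq_iff_dvd.2 ⟨-(k * (q * a₀ - scaledDedekindSum (a₀ * q) t + q * j * t)) + t * z, ?_⟩
    rw [ha]
    linear_combination t * hz - k * htn - t * k * hj
  have haq : IsCoprime a (q : ℤ) := (IsCoprime.of_modEq_left htq hak.symm).of_mul_left_left
  have ha0 : a ≠ 0 := by
    rintro rfl
    rw [isCoprime_zero_left, Int.isUnit_iff] at haq
    omega
  obtain ⟨m, hm⟩ : (t : ℤ) ∣ a ^ 2 + 1 := by
    have : a₀ ≡ a [ZMOD t] := Int.modEq_iff_dvd.2 ⟨j, by rw [ha]; ring⟩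
    exact ((this.pow 2).add_right 1).dvd_iff.1 hta
  have hm0 : 0 < m := by
    have : 0 < t * m := by rw [← hm]; positivity
    exact pos_of_mul_pos_right this ht.le
  have ham : IsCoprime a m := isCoprime_of_dvd_sq_add_one ⟨t, by rw [hm]; ring⟩
  have e := normDedekindSum_mul_eq (m := m) hq0 ha0 ht (by rw [hm]; ring) haq htq hak
  have hcong : a * q ≡ a₀ * q [ZMOD t] := Int.modEq_iff_dvd.2 ⟨-(j * q), by rw [ha]; ring⟩
  refine ⟨a, q * m, by nlinarith [mul_pos hq' hm0], Int.isCoprime_iff_gcd_eq_one.1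
    (haq.mul_right ham), ?_⟩
  rw [e, normDedekindSum_congr ht hcong]
  have qR : (q : ℝ) ≠ 0 := by exact_mod_cast hq0.ne'
  have tR : ((t : ℤ) : ℝ) ≠ 0 := by exact_mod_cast ht.ne'
  have hw := cast_scaledDedekindSum hk hq0
  rw [lambdaVal] at hlam
  have hjR := congrArg (Int.cast : ℤ → ℝ) hj
  push_cast at hjR hlam tR
  rw [hw] at hjR
  rw [ha]
  push_cast
  field_simp at hlam ⊢
  linear_combination hlam - t * hjR

theorem mainTheorem1 (q : ℕ) (hq : 2 ≤ q)
    (h : Even q ∨ (IsSquare q ∧ (3 ∣ q ∨ 5 ∣ q))) :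
    (∀ a t : ℤ, IsAdmissible q a t → ∃ n : ℤ, lambdaVal q a t = (n : ℝ)) ∧
    LambdaSet q = GammaSet q ∧
    (∀ k : ℤ, Int.gcd k (q : ℤ) = 1 →
      ((∃ a b : ℤ, 1 ≤ b ∧ Int.gcd a b = 1 ∧ normDedekindSum a b = (k : ℝ) / (q : ℝ)) ↔
        LocalConditions q k)) := by
  have hq0 : 0 < q := by omega
  have hq2 : Even q ∨ IsSquare q := h.imp_right And.left
  refine ⟨?_, LambdaSet_eq_GammaSet hq h, ?_⟩
  · intro a t hadm
    obtain ⟨t, rfl⟩ := Int.eq_ofNat_of_zero_le hadm.1.le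
    obtain ⟨n, hn, _⟩ := lambdaVal_eq hadm
    exact ⟨n, hn⟩
  · intro k hk
    have hk' := Int.isCoprime_iff_gcd_eq_one.2 hk
    -- An odd q is here a square, hence 1 mod 4, so only the condition mod 8 survives.
    have local_iff : LocalConditions q k ↔
        (¬ 3 ∣ q → 3 ∣ k) ∧ (Odd q → IsSquare q → 8 ∣ k) := by
      unfold LocalConditions
      refine and_congr_right fun _ => ?_
      rw [← even_iff_two_dvd, Nat.not_even_iff_odd]
      refine imp_congr_right fun ho => ?_
      have hsq : IsSquare q := hq2.resolve_left (Nat.not_even_iff_odd.2 ho)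
      have hq4 : ¬ q ≡ 3 [MOD 4] := by
        obtain ⟨c, rfl⟩ := hsq
        have := sq_emod_eight_of_odd (Nat.odd_mul.1 ho).1
        rw [pow_two] at this
        rw [Nat.ModEq]
        omega
      rw [Int.modEq_zero_iff_dvd (n := 8)]
      tauto
    rw [local_iff]
    constructor
    · rintro ⟨a, b, hb, hab, hS⟩
      obtain ⟨b, rfl⟩ := Int.eq_ofNat_of_zero_le (by omega : 0 ≤ b)
      exact dvd_of_normDedekindSum_eq hq0 hk' (by omega) (Int.isCoprime_iff_gcd_eq_one.2 hab) hS
    · rintro ⟨h3, h8⟩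
      have hw := dvd_scaledDedekindSum_self hq0 hk'
      apply exists_normDedekindSum_eq hq hk'
      rw [LambdaSet_eq_GammaSet hq h]
      exact intCast_mem_GammaSet hq0 hq2 (fun h => dvd_sub (h3 h) (hw.1 h))
        (fun ho hs => dvd_sub (h8 ho hs) (hw.2 ho hs))
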